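/- All graphs are finite, simple and undirected; $E(G)$ denotes the edge set of $G$. For a graph $G$ and $B_1,B_2\subseteq E(G)$, a cycle $C$ of $G$ is called $(B_1,B_2)$-unbalanced if $|E(C)\cap B_1|\neq |E(C)\cap B_2|$, and $\mu^*(G,B_1,B_2)$ denotes the minimum number of parts in a partition $\mathcal P$ of the vertex set of $G$ such that for every $P\in\mathcal P$ the subgraph of $G$ induced by $P$ contains no $(B_1,B_2)$-unbalanced cycle. A subdivision of a graph $U$ is a graph obtained from $U$ by replacing the edges $e=uv$ of $U$ by pairwise internally vertex-disjoint paths $P_e$ between $u$ and $v$ (of length at least $1$, with internal vertices not in $U$); the $P_e$ are its branching paths. Let $U$ be a graph, and for every $e\in E(U)$ let $(a_e,b_e,r_e,q_e)$ be a tuple of integers with $q_e\ge 2$ and $\gcd(a_e,q_e)=\gcd(b_e,q_e)=1$. Then there exists an integer $M$ such that the following holds. For every graph $G$ and all $B_1,B_2\subseteq E(G)$ with $\mu^*(G,B_1,B_2)\ge M$, the graph $G$ contains a subgraph isomorphic to a subdivision of $U$ such that for every $e\in E(U)$ the corresponding branching path $P_e$ satisfies $$a_e\,|E(P_e)\cap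 B_1|+b_e\,|E(P_e)\cap B_2|\equiv r_e \pmod{q_e}.$$ -/

import Mathlib

namespace UnbalancedCycles

universe u v

/-- `|E(p) ∩ B|`: the number of (distinct) edges of the walk `p` that lie in `B`. -/
noncomputable def edgeCount {W : Type v} {G : SimpleGraph W} {x y : W} (p : G.Walk x y)
    (B : Set (Sym2 W)) : ℕ :=
  (p.edgeSet ∩ B).ncard

/-- A closed walk is a `(B₁, B₂)`-unbalanced cycle if it is a cycle `C` with
`|E(C) ∩ B₁| ≠ |E(C) ∩ B₂|`. -/
def IsUnbalancedCycle {W : Type v} {G : SimpleGraph W} (B₁ B₂ : Set (Sym2 W)) {x : W}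
    (c : G.Walk x x) : Prop :=
  c.IsCycle ∧ edgeCount c B₁ ≠ edgeCount c B₂

/-- The subgraph of `G` induced by `P` contains no `(B₁, B₂)`-unbalanced cycle. The cycles of
the induced subgraph are the cycles of `G` all of whose vertices lie in `P`. -/
def NoUnbalancedCycleOn {W : Type v} (G : SimpleGraph W) (B₁ B₂ : Set (Sym2 W))
    (P : Set W) : Prop :=
  ∀ (x : W) (c : G.Walk x x), (∀ w ∈ c.support, w ∈ P) → ¬ IsUnbalancedCycle B₁ B₂ c

/-- `μ*(G, B₁, B₂)`: the minimum number of parts in a partition of the vertex set of `G` such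
that no part induces a subgraph containing a `(B₁, B₂)`-unbalanced cycle. -/
noncomputable def muStar {W : Type v} (G : SimpleGraph W) (B₁ B₂ : Set (Sym2 W)) : ℕ∞ :=
  sInf {k : ℕ∞ | ∃ parts : Set (Set W), Setoid.IsPartition parts ∧
    (∀ P ∈ parts, NoUnbalancedCycleOn G B₁ B₂ P) ∧ parts.encard = k}

/-- The internal vertices of a walk. -/
def innerVerts {W : Type v} {G : SimpleGraph W} {x y : W} (p : G.Walk x y) : Set W :=
  {w | w ∈ p.support ∧ w ≠ x ∧ w ≠ y}

/-- The data exhibiting the subgraph `H` of `G` as a subdivision of `U`: the vertices of `U` are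
sent injectively to branching vertices, every edge `e = uv` of `U` is replaced by a branching path
`P_e` between the branching vertices of `u` and `v`, the internal vertices of the branching paths
are not branching vertices, the branching paths are pairwise internally vertex-disjoint, and `H`
consists of exactly the branching vertices and the branching paths. The fields `fst` and `snd`
only fix the direction in which each (undirected) branching path is read. -/
structure Subdivision {V : Type u} {W : Type v} (U : SimpleGraph V) {G : SimpleGraph W}
    (H : G.Subgraph) where
  branch : V ↪ W
  fst : U.edgeSet → V
  snd : U.edgeSet → V
  ends : ∀ e : U.edgeSet, s(fst e, snd e) = (e : Sym2 V)
  path : ∀ e : U.edgeSet, G.Walk (branch (fst e)) (branch (snd e))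
  isPath : ∀ e, (path e).IsPath
  inner_disjoint_branch : ∀ e, Disjoint (innerVerts (path e)) (Set.range branch)
  inner_disjoint : ∀ e f, e ≠ f → Disjoint (innerVerts (path e)) (innerVerts (path f))
  verts_eq : H.verts = Set.range branch ∪ {w | ∃ e, w ∈ (path e).support}
  edgeSet_eq : H.edgeSet = ⋃ e, (path e).edgeSet

end UnbalancedCycles

/-! Let `D` have edge set `symmDiff B₁ B₂`. A cycle within a colour class of `D` avoids the edges of
`D`, so it is balanced; large `muStar` thus forces large chromatic number of `D`. An edge of `D`
lies in exactly one of `B₁`, `B₂`, so its weight is `a e` or `b e`, a unit modulo `q e`. It remains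
to find a subdivision with prescribed path weights in a graph of large chromatic number with unit
edge weights. By `exists_linked_set`, a set `Y` of large chromatic number contains a still highly
chromatic `X` whose vertices are pairwise joined through `Y \ X` by paths of every weight. Iterating
over the edges of `U` reserves disjoint sets `Y \ X`; the branching vertices are chosen in the last
`X`. All residues arise by chaining gadgets (`exists_gadget`), each a choice between two routes
whose weights differ by a unit. -/

namespace UnbalancedCycles

open SimpleGraph

/-! ### Walk weights, highly chromatic sets and distance layers -/

section General

variable {W : Type*} {G : SimpleGraph W} {A : Type*} [AddCommGroup A]

/-- The total weight of the edges of a walk. -/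
def walkWeight (wt : Sym2 W → A) {x y : W} (p : G.Walk x y) : A :=
  (p.edges.map wt).sum

theorem walkWeight_append (wt : Sym2 W → A) {x y z : W} (p : G.Walk x y) (p' : G.Walk y z) :
    walkWeight wt (p.append p') = walkWeight wt p + walkWeight wt p' := by
  simp [walkWeight]

theorem walkWeight_concat (wt : Sym2 W → A) {x y z : W} (p : G.Walk x y) (h : G.Adj y z) :
    walkWeight wt (p.concat h) = walkWeight wt p + wt s(y, z) := by
  simp [walkWeight, Walk.edges_concat]

theorem isPath_append_of_inter {x y z : W} {p : G.Walk x y} {p' : G.Walk y z} (hp : p.IsPath)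
    (hp' : p'.IsPath) (h : ∀ w ∈ p.support, w ∈ p'.support → w = y) : (p.append p').IsPath := by
  rw [Walk.isPath_def, Walk.support_append, List.nodup_append']
  refine ⟨hp.support_nodup, hp'.support_nodup.tail, fun w hw hw' => ?_⟩
  have := h w hw (List.mem_of_mem_tail hw')
  subst this
  have h2 := hp'.support_nodup
  rw [← Walk.cons_tail_support] at h2
  exact (List.nodup_cons.1 h2).1 hw'

/-- Any two vertices of `Y` are joined by a walk inside `Y`. -/
def ConnectedOn (G : SimpleGraph W) (Y : Set W) : Prop :=
  ∀ u ∈ Y, ∀ v ∈ Y, ∃ p : G.Walk u v, ∀ w ∈ p.support, w ∈ Y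

/-- There is a path of weight `s` from `r` to `x` inside `Y` that meets `Z` at most in `x`. -/
def HasEntryPath (G : SimpleGraph W) (wt : Sym2 W → A) (Y Z : Set W) (r x : W) (s : A) : Prop :=
  ∃ p : G.Walk r x, p.IsPath ∧ (∀ w ∈ p.support, w ∈ Y) ∧ (∀ w ∈ p.support, w ∈ Z → w = x) ∧
    walkWeight wt p = s

theorem HasEntryPath.mono {wt : Sym2 W → A} {Y Y' Z Z' : Set W} {r x : W} {s : A}
    (h : HasEntryPath G wt Y Z r x s) (hY : Y ⊆ Y') (hZ : Z' ⊆ Z) :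
    HasEntryPath G wt Y' Z' r x s := by
  obtain ⟨p, h1, h2, h3, h4⟩ := h
  exact ⟨p, h1, fun w hw => hY (h2 w hw), fun w hw hz => h3 w hw (hZ hz), h4⟩

theorem HasEntryPath.trans {wt : Sym2 W → A} {Y Z Z' : Set W} {r x y : W} {s t : A}
    (h : HasEntryPath G wt Y Z r x s) (h' : HasEntryPath G wt Z Z' x y t)
    (hZ : Z ⊆ Y) (hZ' : Z' ⊆ Z) : HasEntryPath G wt Y Z' r y (s + t) := by
  obtain ⟨p, h1, h2, h3, h4⟩ := h
  obtain ⟨p', h1', h2', h3', h4'⟩ := h'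
  refine ⟨p.append p', isPath_append_of_inter h1 h1' fun w hw hw' => h3 w hw (h2' w hw'),
    fun w hw => ?_, fun w hw hwz => ?_, by rw [walkWeight_append, h4, h4']⟩
  · rcases Walk.mem_support_append_iff _ _ |>.1 hw with hw | hw
    exacts [h2 w hw, hZ (h2' w hw)]
  · rcases Walk.mem_support_append_iff _ _ |>.1 hw with hw | hw
    · have := h3 w hw (hZ' hwz)
      subst this
      exact h3' _ p'.start_mem_support hwz
    · exact h3' w hw hwz

theorem nonempty_of_not_colorable {X : Set W} {k : ℕ} (h : ¬ (G.induce X).Colorable k) :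
    X.Nonempty := by
  by_contra hX
  rw [Set.not_nonempty_iff_eq_empty] at hX
  subst hX
  exact h ⟨Coloring.mk (fun v => v.2.elim) fun {u} => u.2.elim⟩

theorem not_colorable_diff_singleton {X : Set W} {k : ℕ} (y : W)
    (h : ¬ (G.induce X).Colorable (k + 1)) : ¬ (G.induce (X \ {y})).Colorable k := by
  classical
  rintro ⟨c⟩
  refine h ?_
  have C : (G.induce X).Coloring (Option (Fin k)) :=
    Coloring.mk (fun v => if hv : (v : W) = y then none else some (c ⟨v, v.2, hv⟩)) (by
      intro u v huv
      have huv' : G.Adj u v := huv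
      by_cases hu : (u : W) = y <;> by_cases hv : (v : W) = y
      · exact (huv'.ne (hu.trans hv.symm)).elim
      · simp [hu, hv]
      · simp [hu, hv]
      · simp only [hu, hv, dite_false, ne_eq, Option.some.injEq]
        exact c.valid (show (G.induce (X \ {y})).Adj ⟨u, u.2, hu⟩ ⟨v, v.2, hv⟩ from huv'))
  simpa using C.colorable

/-- Otherwise colourings of the components of `G.induce Y` would combine into one of `Y`. -/
theorem exists_component_not_colorable {Y : Set W} {k : ℕ} (h : ¬ (G.induce Y).Colorable k) :
    ∃ Z ⊆ Y, ConnectedOn G Z ∧ ¬ (G.induce Z).Colorable k ∧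
      ∀ u ∈ Z, ∀ v ∈ Y, G.Adj u v → v ∈ Z := by
  classical
  by_contra! hc
  let H := G.induce Y
  have key : ∀ C : H.ConnectedComponent,
      (G.induce (Subtype.val '' C.supp)).Colorable k := by
    intro C
    by_contra hC
    obtain ⟨u, ⟨u', hu', rfl⟩, v, hv, huv, hvn⟩ := hc (Subtype.val '' C.supp) (by
        rintro _ ⟨v, -, rfl⟩; exact v.2) (by
        rintro _ ⟨u, hu, rfl⟩ _ ⟨v, hv, rfl⟩
        have huv : H.connectedComponentMk u = H.connectedComponentMk v := by
          rw [ConnectedComponent.mem_supp_iff] at hu hv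
          rw [hu, hv]
        obtain ⟨p⟩ := ConnectedComponent.exact huv
        refine ⟨Walk.map (Embedding.induce Y).toHom p, fun w hw => ?_⟩
        obtain ⟨w', hw', rfl⟩ := List.mem_map.1 (Walk.support_map _ p ▸ hw)
        refine ⟨w', ?_, rfl⟩
        rw [ConnectedComponent.mem_supp_iff] at hu ⊢
        rw [← hu]
        exact ConnectedComponent.sound (p.takeUntil w' hw').reachable.symm) hC
    refine hvn ⟨⟨v, hv⟩, ?_, rfl⟩
    rw [ConnectedComponent.mem_supp_iff] at hu' ⊢
    rw [← hu']
    have : H.Adj ⟨v, hv⟩ u' := huv.symm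
    exact ConnectedComponent.sound this.reachable
  let c := fun C => (key C).some
  refine h ⟨Coloring.mk (fun v => c (H.connectedComponentMk v) ⟨v, v, rfl, rfl⟩) ?_⟩
  intro u v huv
  have e : H.connectedComponentMk u = H.connectedComponentMk v :=
    ConnectedComponent.sound huv.reachable
  have aux : ∀ C C' (_ : C = C') (hu : (u : W) ∈ Subtype.val '' C.supp)
      (hv : (v : W) ∈ Subtype.val '' C'.supp), c C ⟨u, hu⟩ ≠ c C' ⟨v, hv⟩ := by
    rintro C _ rfl hu hv
    exact (c C).valid (show (G.induce (Subtype.val '' C.supp)).Adj ⟨u, hu⟩ ⟨v, hv⟩ from huv)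
  exact aux _ _ e _ _

/-- The least length of a walk from `r` to `y` inside `Y`. -/
noncomputable def distOn (G : SimpleGraph W) (Y : Set W) (r y : W) : ℕ :=
  sInf {n | ∃ p : G.Walk r y, (∀ w ∈ p.support, w ∈ Y) ∧ p.length = n}

theorem distOn_le {Y : Set W} {r y : W} (p : G.Walk r y) (hp : ∀ w ∈ p.support, w ∈ Y) :
    distOn G Y r y ≤ p.length :=
  Nat.sInf_le ⟨p, hp, rfl⟩

theorem exists_path_length_eq_distOn {Y : Set W} (hY : ConnectedOn G Y) {r y : W} (hr : r ∈ Y)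
    (hy : y ∈ Y) : ∃ p : G.Walk r y, p.IsPath ∧ (∀ w ∈ p.support, w ∈ Y) ∧
      p.length = distOn G Y r y ∧ ∀ w ∈ p.support, w ≠ y → distOn G Y r w < distOn G Y r y := by
  classical
  obtain ⟨p₀, hp₀⟩ := hY r hr y hy
  obtain ⟨p, hp, hl⟩ := Nat.sInf_mem (s := {n | ∃ p : G.Walk r y, (∀ w ∈ p.support, w ∈ Y) ∧
    p.length = n}) ⟨_, p₀, hp₀, rfl⟩
  change p.length = distOn G Y r y at hl
  have hb : ∀ w ∈ p.bypass.support, w ∈ Y := fun w hw => hp w (p.support_bypass_subset_support hw)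
  have hbl : p.bypass.length = distOn G Y r y :=
    le_antisymm (p.length_bypass_le_length.trans hl.le) (distOn_le _ hb)
  refine ⟨p.bypass, p.bypass_isPath, hb, hbl, fun w hw hwy => ?_⟩
  rw [← hbl]
  exact (distOn_le (p.bypass.takeUntil w hw) fun z hz =>
    hb z (Walk.support_takeUntil_subset_support _ hw hz)).trans_lt
      (Walk.length_takeUntil_lt_length hw hwy)

theorem distOn_le_succ {Y : Set W} (hY : ConnectedOn G Y) {r x y : W} (hr : r ∈ Y)
    (hx : x ∈ Y) (hy : y ∈ Y) (h : G.Adj x y) : distOn G Y r y ≤ distOn G Y r x + 1 := by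
  obtain ⟨p, -, hp, hl, -⟩ := exists_path_length_eq_distOn hY hr hx
  rw [← hl, ← Walk.length_concat p h]
  refine distOn_le _ fun w hw => ?_
  rw [Walk.support_concat, List.mem_append, List.mem_singleton] at hw
  rcases hw with hw | rfl
  exacts [hp w hw, hy]

/-- Fix a shortest path from `r` to each vertex and group vertices by distance and path weight.
Earlier vertices of a shortest path are strictly closer to `r`, so it meets its group only at its
end. -/
theorem exists_layer [Fintype A] (wt : Sym2 W → A) {Y : Set W} (hY : ConnectedOn G Y) {r : W}
    (hr : r ∈ Y) {k : ℕ} (h : ¬ (G.induce Y).Colorable (2 * Fintype.card A * k)) :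
    ∃ X ⊆ Y, ¬ (G.induce X).Colorable k ∧ ∃ s : A, ∀ x ∈ X, HasEntryPath G wt Y X r x s := by
  classical
  choose p hpath hsupp _ hlt using
    fun y (hy : y ∈ Y) => exists_path_length_eq_distOn hY hr hy
  let ω : W → A := fun y => if hy : y ∈ Y then walkWeight wt (p y hy) else 0
  by_contra! hc
  have key : ∀ (i : ℕ) (s : A), (G.induce {y | y ∈ Y ∧ distOn G Y r y = i ∧
      ω y = s}).Colorable k := by
    intro i s
    by_contra hn
    obtain ⟨x, hx, hxn⟩ := hc _ (fun y hy => hy.1) hn s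
    refine hxn ⟨p x hx.1, hpath x hx.1, hsupp x hx.1, fun w hw hwX => ?_,
      (dif_pos hx.1).symm.trans hx.2.2⟩
    by_contra hwx
    exact (hlt x hx.1 w hw hwx).ne (hwX.2.1.trans hx.2.1.symm)
  let c := fun i s => (key i s).some
  -- Distances of adjacent vertices differ by at most one, so parity suffices to separate layers;
  -- this gives the factor 2.
  have C : (G.induce Y).Coloring (Fin 2 × A × Fin k) :=
    Coloring.mk (fun y => (⟨distOn G Y r y % 2, Nat.mod_lt _ two_pos⟩, ω y,
      c (distOn G Y r y) (ω y) ⟨y, y.2, rfl, rfl⟩)) (by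
      rintro ⟨u, hu⟩ ⟨v, hv⟩ huv he
      have huv : G.Adj u v := huv
      simp only [Prod.mk.injEq, Fin.mk.injEq] at he
      obtain ⟨h1, h2, h3⟩ := he
      have hd : distOn G Y r u = distOn G Y r v := by
        have := distOn_le_succ hY hr hu hv huv
        have := distOn_le_succ hY hr hv hu huv.symm
        omega
      have aux : ∀ i j s t (_ : i = j) (_ : s = t) hu' hv',
          c i s ⟨u, hu'⟩ ≠ c j t ⟨v, hv'⟩ := by
        rintro i _ s _ rfl rfl hu' hv'
        exact (c i s).valid (show (G.induce _).Adj ⟨u, hu'⟩ ⟨v, hv'⟩ from huv)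
      exact aux _ _ _ _ hd h2 _ _ h3)
  refine h ?_
  have := C.colorable
  simpa [mul_assoc] using this

/-- In a connected layer `X`, delete a vertex `y` and keep a highly chromatic component `Z` of the
rest. Some `x ∈ Z` is adjacent to `y`; it is reached directly, or through `y` and the edge `yx`, the
layer paths to `x` and `y` having equal weight. -/
theorem exists_gadget [Fintype A] (wt : Sym2 W → A) {Y : Set W} (hY : ConnectedOn G Y) {r : W}
    (hr : r ∈ Y) {k : ℕ} (h : ¬ (G.induce Y).Colorable (2 * Fintype.card A * (k + 1))) :
    ∃ Z ⊆ Y, ConnectedOn G Z ∧ ¬ (G.induce Z).Colorable k ∧ ∃ x ∈ Z, ∃ s : A,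
      ∃ e ∈ G.edgeSet, HasEntryPath G wt Y Z r x s ∧ HasEntryPath G wt Y Z r x (s + wt e) := by
  obtain ⟨X₀, hX₀, hcol₀, s, hs⟩ := exists_layer wt hY hr h
  obtain ⟨X, hX, hXc, hcol, -⟩ := exists_component_not_colorable hcol₀
  obtain ⟨y, hy⟩ := nonempty_of_not_colorable hcol
  obtain ⟨Z, hZ, hZc, hZcol, hZcl⟩ :=
    exists_component_not_colorable (not_colorable_diff_singleton y hcol)
  obtain ⟨z, hz⟩ := nonempty_of_not_colorable hZcol
  obtain ⟨p, hp⟩ := hXc z (hZ hz).1 y hy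
  obtain ⟨d, hd, hd1, hd2⟩ := p.exists_boundary_dart Z hz fun hyZ => (hZ hyZ).2 rfl
  have hdy : d.snd = y := by
    by_contra hne
    exact hd2 (hZcl _ hd1 _ ⟨hp _ (p.dart_snd_mem_support_of_mem_darts hd), hne⟩ d.adj)
  have hadj : G.Adj y d.fst := hdy ▸ d.adj.symm
  have hZX₀ : Z ⊆ X₀ := fun w hw => hX (hZ hw).1
  refine ⟨Z, hZX₀.trans hX₀, hZc, hZcol, d.fst, hd1, s, s(y, d.fst), hadj,
    (hs _ (hZX₀ hd1)).mono le_rfl hZX₀, ?_⟩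
  obtain ⟨p', h1, h2, h3, h4⟩ := hs y (hX hy)
  refine ⟨p'.concat hadj, h1.concat (fun hm => ?_) hadj, fun w hw => ?_, fun w hw hwZ => ?_,
    by rw [walkWeight_concat, h4]⟩
  · exact hadj.ne (h3 _ hm (hZX₀ hd1)).symm
  · rw [Walk.support_concat, List.mem_append, List.mem_singleton] at hw
    rcases hw with hw | rfl
    exacts [h2 w hw, hX₀ (hZX₀ hd1)]
  · rw [Walk.support_concat, List.mem_append, List.mem_singleton] at hw
    rcases hw with hw | rfl
    · have := h3 w hw (hZX₀ hwZ)
      exact ((hZ hwZ).2 this).elim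
    · rfl

end General

/-! ### Realising every residue -/

theorem ZMod.eq_univ_of_forall_add_mem {n : ℕ} [NeZero n] {c : ZMod n} (hc : IsUnit c)
    {S : Finset (ZMod n)} (hS : S.Nonempty) (h : ∀ s ∈ S, s + c ∈ S) : S = Finset.univ := by
  obtain ⟨s, hs⟩ := hS
  have hm : ∀ m : ℕ, s + m * c ∈ S := by
    intro m
    induction m with
    | zero => simpa using hs
    | succ m ih => simpa [add_mul, add_assoc] using h _ ih
  refine Finset.eq_univ_iff_forall.2 fun t => ?_
  obtain ⟨u, rfl⟩ := hc
  have := hm ((t - s) * (u⁻¹ : (ZMod n)ˣ)).val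
  rwa [ZMod.natCast_zmod_val, mul_assoc, Units.inv_mul, mul_one, add_sub_cancel] at this

/-- Appending a gadget replaces `S` by the union of two translates of `S` that differ by a unit.
This is larger than `S` unless `S` is invariant under adding that unit, hence everything. -/
theorem exists_chain (n : ℕ) [NeZero n] (m k : ℕ) : ∃ K : ℕ, ∀ {W : Type*} (G : SimpleGraph W)
    (wt : Sym2 W → ZMod n), (∀ e ∈ G.edgeSet, IsUnit (wt e)) → ∀ (Y : Set W) (r : W),
    ConnectedOn G Y → r ∈ Y → ¬ (G.induce Y).Colorable K →
    ∃ Z ⊆ Y, ConnectedOn G Z ∧ ¬ (G.induce Z).Colorable k ∧ ∃ x ∈ Z, ∃ S : Finset (ZMod n),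
      (S = Finset.univ ∨ m < S.card) ∧ ∀ s ∈ S, HasEntryPath G wt Y Z r x s := by
  classical
  induction m generalizing k with
  | zero =>
    refine ⟨2 * Fintype.card (ZMod n) * (k + 1), fun G wt hwt Y r hY hr h => ?_⟩
    obtain ⟨Z, hZ, hZc, hcol, x, hx, s, e, he, h1, h2⟩ := exists_gadget wt hY hr h
    exact ⟨Z, hZ, hZc, hcol, x, hx, {s}, Or.inr (by simp), by simpa using h1⟩
  | succ m ih =>
    obtain ⟨K, hK⟩ := ih (2 * Fintype.card (ZMod n) * (k + 1))
    refine ⟨K, fun G wt hwt Y r hY hr h => ?_⟩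
    obtain ⟨Y', hY', hYc', hcol', x', hx', S, hS, hSp⟩ := hK G wt hwt Y r hY hr h
    obtain ⟨Z, hZ, hZc, hcol, x, hx, s, e, he, h1, h2⟩ := exists_gadget wt hYc' hx' hcol'
    refine ⟨Z, hZ.trans hY', hZc, hcol, x, hx,
      S.image (· + s) ∪ S.image (· + (s + wt e)), ?_, ?_⟩
    · have hinj : ∀ t : ZMod n, (S.image (· + t)).card = S.card := fun t =>
        Finset.card_image_of_injective _ (add_left_injective t)
      by_cases hun : S = Finset.univ
      · left
        refine Finset.eq_univ_iff_forall.2 fun t => Finset.mem_union_left _ ?_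
        exact Finset.mem_image.2 ⟨t - s, by simp [hun], by simp⟩
      right
      have hmS : m < S.card := hS.resolve_left hun
      by_contra hlt
      have hle := Finset.card_le_card
        (Finset.subset_union_left (s₁ := S.image (· + s)) (s₂ := S.image (· + (s + wt e))))
      rw [hinj] at hle
      have heq := Finset.eq_of_subset_of_card_le
        (Finset.subset_union_left (s₁ := S.image (· + s)) (s₂ := S.image (· + (s + wt e))))
        (by rw [hinj]; omega)
      refine hun (ZMod.eq_univ_of_forall_add_mem (hwt e he)
        (Finset.card_pos.1 (by omega)) fun t ht => ?_)
      have : t + (s + wt e) ∈ S.image (· + s) := by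
        rw [heq]
        exact Finset.mem_union_right _ (Finset.mem_image_of_mem _ ht)
      obtain ⟨t', ht', he'⟩ := Finset.mem_image.1 this
      have : t' = t + wt e := by
        apply add_right_cancel (b := s)
        rw [he']; abel
      exact this ▸ ht'
    · intro t ht
      rcases Finset.mem_union.1 ht with ht | ht <;>
      obtain ⟨t', ht', rfl⟩ := Finset.mem_image.1 ht
      · exact (hSp t' ht').trans h1 hY' hZ
      · exact (hSp t' ht').trans h2 hY' hZ

theorem exists_linked_set (n : ℕ) [NeZero n] (k : ℕ) : ∃ K : ℕ, ∀ {W : Type*} (G : SimpleGraph W)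
    (wt : Sym2 W → ZMod n), (∀ e ∈ G.edgeSet, IsUnit (wt e)) → ∀ Y : Set W,
    ¬ (G.induce Y).Colorable K →
    ∃ X ⊆ Y, ¬ (G.induce X).Colorable k ∧ ∀ u ∈ X, ∀ v ∈ X, u ≠ v → ∀ s : ZMod n,
      ∃ p : G.Walk u v, p.IsPath ∧ innerVerts p ⊆ Y \ X ∧ walkWeight wt p = s := by
  classical
  -- With `m = n` the alternative `m < S.card` is impossible, so all residues occur.
  obtain ⟨K, hK⟩ := exists_chain n n (2 * Fintype.card (ZMod n) * k)
  refine ⟨2 * Fintype.card (ZMod n) * K, fun G wt hwt Y h => ?_⟩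
  obtain ⟨Y₀, hY₀, hYc₀, hcol₀, -⟩ := exists_component_not_colorable h
  obtain ⟨r, hr⟩ := nonempty_of_not_colorable hcol₀
  obtain ⟨X₀, hX₀, hXcol₀, _, hX₀p⟩ := exists_layer wt hYc₀ hr hcol₀
  obtain ⟨Y₁, hY₁, hYc₁, hcol₁, -⟩ := exists_component_not_colorable hXcol₀
  obtain ⟨r₁, hr₁⟩ := nonempty_of_not_colorable hcol₁
  obtain ⟨Z, hZ, hZc, hZcol, x, hx, S, hS, hSp⟩ := hK G wt hwt Y₁ r₁ hYc₁ hr₁ hcol₁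
  have hSu : S = Finset.univ := by
    refine hS.resolve_right fun hlt => ?_
    have := Finset.card_le_univ S
    rw [ZMod.card] at this
    omega
  obtain ⟨X, hX, hXcol, s₂, hXp⟩ := exists_layer wt hZc hx hZcol
  have hXX₀ : X ⊆ X₀ := fun w hw => hY₁ (hZ (hX hw))
  -- The path runs from `u` outside `X₀` to `r₁`, along the chain to `x`, then to `v` in the last
  -- layer. The first leg may have any weight and the last has weight `s₂`; the chain supplies the
  -- difference.
  refine ⟨X, hXX₀.trans (hX₀.trans hY₀), hXcol, fun u hu v hv huv s => ?_⟩
  obtain ⟨p₁, -, hp₁Y, hp₁X, -⟩ := hX₀p u (hXX₀ hu)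
  obtain ⟨p₂, -, hp₂Y, hp₂X, -⟩ := hX₀p r₁ (hY₁ hr₁)
  set p := (p₁.reverse.append p₂).bypass with hp
  have hps : ∀ w ∈ p.support, w ∈ p₁.support ∨ w ∈ p₂.support := by
    intro w hw
    have := Walk.support_bypass_subset_support _ hw
    rw [Walk.mem_support_append_iff, Walk.support_reverse, List.mem_reverse] at this
    exact this
  have hpY : ∀ w ∈ p.support, w ∈ Y₀ := fun w hw => (hps w hw).elim (hp₁Y w) (hp₂Y w)
  have hpX : ∀ w ∈ p.support, w ∈ X₀ → w = u ∨ w = r₁ := fun w hw hwX =>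
    (hps w hw).imp (fun h => hp₁X w h hwX) (fun h => hp₂X w h hwX)
  obtain ⟨p', h1, h2, h3, h4⟩ := (hSp (s - walkWeight wt p - s₂) (by simp [hSu])).trans
    (hXp v hv) hZ hX
  have hinter : ∀ w ∈ p.support, w ∈ p'.support → w = r₁ := by
    intro w hw hw'
    refine (hpX w hw (hY₁ (h2 w hw'))).resolve_left ?_
    rintro rfl
    exact huv (h3 w hw' hu)
  refine ⟨p.append p', isPath_append_of_inter (Walk.bypass_isPath _) h1 hinter, ?_,
    by rw [walkWeight_append, h4]; abel⟩
  rintro w ⟨hw, hwu, hwv⟩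
  rcases (Walk.mem_support_append_iff _ _).1 hw with hw | hw
  · refine ⟨hY₀ (hpY w hw), fun hwX => ?_⟩
    have := (hpX w hw (hXX₀ hwX)).resolve_left hwu
    subst this
    exact hwv (h3 _ p'.start_mem_support hwX)
  · exact ⟨hY₀ (hX₀ (hY₁ (h2 w hw))), fun hwX => hwv (h3 w hw hwX)⟩

theorem colorable_of_isEmpty_embedding {W V : Type*} [Finite W] [Finite V] {G : SimpleGraph W}
    {Y : Set W} (h : IsEmpty (V ↪ Y)) : (G.induce Y).Colorable (Nat.card V) := by
  classical
  have := Fintype.ofFinite W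
  have := Fintype.ofFinite V
  have := Fintype.ofFinite Y
  rw [Nat.card_eq_fintype_card]
  refine (G.induce Y).colorable_of_fintype.mono ?_
  by_contra! hlt
  exact h.elim' (Function.Embedding.nonempty_of_card_le hlt.le).some

/-- The sets `I e` serve the induction: a new edge gets `Y \ X`, while everything found earlier lies
inside `X`. -/
theorem exists_weighted_subdivision {V E : Type*} [Finite V] (n : E → ℕ) [∀ e, NeZero (n e)]
    (x y : E → V) (hxy : ∀ e, x e ≠ y e) (s : ∀ e, ZMod (n e)) (F : Finset E) :
    ∃ K : ℕ, ∀ {W : Type*} [Finite W] (G : SimpleGraph W) (wt : ∀ e, Sym2 W → ZMod (n e)),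
      (∀ e, ∀ ε ∈ G.edgeSet, IsUnit (wt e ε)) → ∀ Y : Set W, ¬ (G.induce Y).Colorable K →
      ∃ (f : V ↪ W) (I : E → Set W), (∀ v, f v ∈ Y) ∧ (∀ e ∈ F, I e ⊆ Y) ∧
        (∀ e ∈ F, Disjoint (I e) (Set.range f)) ∧
        (∀ e ∈ F, ∀ e' ∈ F, e ≠ e' → Disjoint (I e) (I e')) ∧
        ∀ e ∈ F, ∃ p : G.Walk (f (x e)) (f (y e)), p.IsPath ∧ innerVerts p ⊆ I e ∧
          walkWeight (wt e) p = s e := by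
  classical
  induction F using Finset.induction_on with
  | empty =>
    refine ⟨Nat.card V, fun G wt _ Y h => ?_⟩
    obtain ⟨f⟩ := not_isEmpty_iff.1 (mt colorable_of_isEmpty_embedding h)
    exact ⟨f.trans (Function.Embedding.subtype _), fun _ => ∅, fun v => (f v).2, by simp⟩
  | insert e₀ F he₀ ih =>
    obtain ⟨k, hk⟩ := ih
    obtain ⟨K, hK⟩ := exists_linked_set (n e₀) k
    refine ⟨K, fun G wt hwt Y h => ?_⟩
    obtain ⟨X, hX, hcol, hlink⟩ := hK G (wt e₀) (hwt e₀) Y h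
    obtain ⟨f, I, hf, hI, hIf, hII, hp⟩ := hk G wt hwt X hcol
    have hne : ∀ e ∈ F, e ≠ e₀ := fun e he h => he₀ (h ▸ he)
    have hold : ∀ e ∈ F, Function.update I e₀ (Y \ X) e = I e := fun e he =>
      Function.update_of_ne (hne e he) _ _
    refine ⟨f, Function.update I e₀ (Y \ X), fun v => hX (hf v), ?_, ?_, ?_, ?_⟩
    · rw [Finset.forall_mem_insert]
      refine ⟨?_, fun e he => ?_⟩
      · simp
      · rw [hold e he]
        exact (hI e he).trans hX
    · rw [Finset.forall_mem_insert]
      refine ⟨?_, fun e he => ?_⟩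
      · rw [Function.update_self, Set.disjoint_left]
        rintro _ hw ⟨v, rfl⟩
        exact hw.2 (hf v)
      · rw [hold e he]
        exact hIf e he
    · have hd : ∀ e ∈ F, Disjoint (Y \ X) (I e) := fun e he =>
        Set.disjoint_left.2 fun w hw hwI => hw.2 (hI e he hwI)
      intro e he e' he' hee
      rcases Finset.mem_insert.1 he with h | he <;> rcases Finset.mem_insert.1 he' with h' | he'
      · exact (hee (h.trans h'.symm)).elim
      · rw [hold e' he', h, Function.update_self]
        exact hd e' he'
      · rw [hold e he, h', Function.update_self]
        exact (hd e he).symm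
      · rw [hold e he, hold e' he']
        exact hII e he e' he' hee
    · rw [Finset.forall_mem_insert]
      refine ⟨?_, fun e he => ?_⟩
      · rw [Function.update_self]
        exact hlink _ (hf _) _ (hf _) (f.injective.ne (hxy e₀)) _
      · rw [hold e he]
        exact hp e he

/-! ### Edge counts as weights, and the bound on `muStar` -/

section Counting

variable {W : Type*} {G : SimpleGraph W}

open Classical in
theorem edgeCount_eq_countP {x y : W} {p : G.Walk x y} (hp : p.IsPath) (B : Set (Sym2 W)) :
    edgeCount p B = p.edges.countP (· ∈ B) := by
  have h : p.edgeSet ∩ B = ((p.edges.filter (· ∈ B)).toFinset : Set (Sym2 W)) := by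
    ext e
    simp [Walk.mem_edgeSet]
  rw [edgeCount, h, Set.ncard_coe_finset,
    List.toFinset_card_of_nodup (hp.isTrail.edges_nodup.filter _), List.countP_eq_length_filter]

open Classical in
/-- The weight of an edge that makes the weight of a path `p` equal to
`α * |E(p) ∩ B₁| + β * |E(p) ∩ B₂|`. -/
noncomputable def pairWeight {R : Type*} [CommRing R] (α β : R) (B₁ B₂ : Set (Sym2 W))
    (e : Sym2 W) : R :=
  (if e ∈ B₁ then α else 0) + (if e ∈ B₂ then β else 0)

theorem walkWeight_pairWeight {R : Type*} [CommRing R] (α β : R) (B₁ B₂ : Set (Sym2 W)) {x y : W}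
    {p : G.Walk x y} (hp : p.IsPath) : walkWeight (pairWeight α β B₁ B₂) p =
      α * (edgeCount p B₁ : R) + β * (edgeCount p B₂ : R) := by
  classical
  rw [edgeCount_eq_countP hp, edgeCount_eq_countP hp, walkWeight]
  induction p.edges with
  | nil => simp
  | cons e l ih =>
    rw [List.map_cons, List.sum_cons, ih, List.countP_cons, List.countP_cons]
    by_cases h1 : e ∈ B₁ <;> by_cases h2 : e ∈ B₂ <;> simp [pairWeight, h1, h2] <;> ring

theorem muStar_le_of_colorable {B₁ B₂ : Set (Sym2 W)} {k : ℕ}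
    (h : (fromEdgeSet (symmDiff B₁ B₂)).Colorable k) : muStar G B₁ B₂ ≤ k := by
  obtain ⟨c⟩ := h
  have hle : (Setoid.ker c).classes.encard ≤ k := by
    refine (Set.encard_le_encard (Setoid.classes_ker_subset_fiber_set c)).trans ?_
    rw [← Set.image_univ]
    refine (Set.encard_image_le _ _).trans ?_
    simp [Set.encard_univ]
  unfold muStar
  refine le_trans (sInf_le ⟨(Setoid.ker c).classes, Setoid.isPartition_classes _, ?_, rfl⟩) hle
  rintro _ ⟨w, rfl⟩ x p hp ⟨-, hne⟩
  refine hne ?_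
  have key : ∀ e ∈ p.edgeSet, (e ∈ B₁ ↔ e ∈ B₂) := by
    intro e
    induction e using Sym2.ind with
    | _ u v =>
      intro he
      by_contra hB
      have hu : c u = c w := hp u (p.fst_mem_support_of_mem_edges he)
      have hv : c v = c w := hp v (p.snd_mem_support_of_mem_edges he)
      refine c.valid (v := u) (w := v) ?_ (hu.trans hv.symm)
      rw [fromEdgeSet_adj, Set.mem_symmDiff]
      exact ⟨by tauto, (p.adj_of_mem_edges he).ne⟩
  rw [edgeCount, edgeCount]
  congr 1
  ext e
  exact and_congr_right (key e)

end Counting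

/-! ### Assembling the subdivision -/

/-- The union of the branching vertices and the branching paths. -/
def pathsSubgraph {V W E : Type*} {G : SimpleGraph W} (f : V → W) {x y : E → W}
    (p : ∀ e, G.Walk (x e) (y e)) : G.Subgraph where
  verts := Set.range f ∪ {w | ∃ e, w ∈ (p e).support}
  Adj u v := ∃ e, s(u, v) ∈ (p e).edges
  adj_sub := fun ⟨e, h⟩ => (p e).adj_of_mem_edges h
  edge_vert := fun ⟨e, h⟩ => Or.inr ⟨e, (p e).fst_mem_support_of_mem_edges h⟩
  symm := ⟨fun _ _ ⟨e, h⟩ => ⟨e, Sym2.eq_swap ▸ h⟩⟩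

end UnbalancedCycles

open UnbalancedCycles in
theorem mainTheorem3 {V : Type*} [Finite V] (U : SimpleGraph V)
    (a b r q : U.edgeSet → ℤ)
    (hq : ∀ e, 2 ≤ q e)
    (ha : ∀ e, Int.gcd (a e) (q e) = 1)
    (hb : ∀ e, Int.gcd (b e) (q e) = 1) :
    ∃ M : ℕ, ∀ (W : Type*) [Finite W] (G : SimpleGraph W) (B₁ B₂ : Set (Sym2 W)),
      B₁ ⊆ G.edgeSet → B₂ ⊆ G.edgeSet →
      (M : ℕ∞) ≤ UnbalancedCycles.muStar G B₁ B₂ →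
      ∃ (H : G.Subgraph) (S : UnbalancedCycles.Subdivision U H), ∀ e : U.edgeSet,
        a e * (UnbalancedCycles.edgeCount (S.path e) B₁ : ℤ)
          + b e * (UnbalancedCycles.edgeCount (S.path e) B₂ : ℤ) ≡ r e [ZMOD q e] := by
  classical
  have := Fintype.ofFinite U.edgeSet
  let n : U.edgeSet → ℕ := fun e => (q e).natAbs
  have hn : ∀ e, (n e : ℤ) = q e := fun e => Int.natAbs_of_nonneg (by linarith [hq e])
  have : ∀ e, NeZero (n e) := fun e => ⟨by have := hq e; have := hn e; omega⟩
  have hunit : ∀ e (c : ℤ), Int.gcd c (q e) = 1 → IsUnit (c : ZMod (n e)) := by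
    intro e c hc
    rw [ZMod.coe_int_isUnit_iff_isCoprime, hn, isCoprime_comm]
    exact Int.isCoprime_iff_gcd_eq_one.2 hc
  let x : U.edgeSet → V := fun e => e.1.out.1
  let y : U.edgeSet → V := fun e => e.1.out.2
  have hends : ∀ e : U.edgeSet, s(x e, y e) = (e : Sym2 V) := fun e => e.1.out_eq
  have hxy : ∀ e, x e ≠ y e := by
    intro e
    have := e.2
    rw [← hends e, SimpleGraph.mem_edgeSet] at this
    exact this.ne
  obtain ⟨K, hK⟩ := exists_weighted_subdivision n x y hxy (fun e => (r e : ZMod (n e)))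
    Finset.univ
  refine ⟨K + 1, fun W _ G B₁ B₂ hB₁ hB₂ hM => ?_⟩
  let D : SimpleGraph W := SimpleGraph.fromEdgeSet (symmDiff B₁ B₂)
  have hDG : D ≤ G := by
    intro u v h
    rw [SimpleGraph.fromEdgeSet_adj, Set.mem_symmDiff] at h
    rcases h.1 with h | h
    exacts [hB₁ h.1, hB₂ h.1]
  have hD : ¬ (D.induce Set.univ).Colorable K := by
    intro h
    have hc : D.Colorable K := h.of_hom (D.induceUnivIso.symm.toHom)
    have := hM.trans (muStar_le_of_colorable hc)
    rw [Nat.cast_le] at this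
    omega
  obtain ⟨f, I, -, -, hIf, hII, hp⟩ := hK D
    (fun e => pairWeight (a e : ZMod (n e)) (b e : ZMod (n e)) B₁ B₂) (by
      intro e ε hε
      have hε' : ε ∈ symmDiff B₁ B₂ := by
        rw [SimpleGraph.edgeSet_fromEdgeSet] at hε
        exact hε.1
      rcases Set.mem_symmDiff.1 hε' with h | h
      · simpa [pairWeight, h.1, h.2] using hunit e _ (ha e)
      · simpa [pairWeight, h.1, h.2] using hunit e _ (hb e)) Set.univ hD
  choose p hpath hpI hpw using fun e => hp e (Finset.mem_univ e)
  have hmap : ∀ e, innerVerts ((p e).mapLe hDG) ⊆ I e := by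
    intro e w hw
    refine hpI e ⟨?_, hw.2⟩
    simpa using hw.1
  refine ⟨pathsSubgraph f fun e => (p e).mapLe hDG,
    { branch := f
      fst := x
      snd := y
      ends := hends
      path := fun e => (p e).mapLe hDG
      isPath := fun e => (hpath e).mapLe hDG
      inner_disjoint_branch := fun e => (hIf e (Finset.mem_univ e)).mono_left (hmap e)
      inner_disjoint := fun e e' h =>
        (hII e (Finset.mem_univ e) e' (Finset.mem_univ e') h).mono (hmap e) (hmap e')
      verts_eq := rfl
      edgeSet_eq := ?_ }, fun e => ?_⟩
  · ext ε
    induction ε using Sym2.ind with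
    | _ u v =>
      rw [SimpleGraph.Subgraph.mem_edgeSet, Set.mem_iUnion]
      rfl
  · have h := walkWeight_pairWeight (a e : ZMod (n e)) (b e : ZMod (n e)) B₁ B₂
      ((hpath e).mapLe hDG)
    have hw : walkWeight (pairWeight (a e : ZMod (n e)) (b e : ZMod (n e)) B₁ B₂)
        ((p e).mapLe hDG) = (r e : ZMod (n e)) := by
      -- Passing from `D` to `G` keeps the edge list, hence the weight.
      rw [← hpw e, walkWeight, walkWeight, SimpleGraph.Walk.edges_mapLe_eq_edges]
    rw [hw] at h
    rw [← hn e, ← ZMod.intCast_eq_intCast_iff]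
    push_cast
    exact h.symm
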